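/- Edit distance between binary strings is $d_{\mathrm{edit}}(x,x') = |x|+|x'|-2\,|\mathrm{LCS}(x,x')|$, where $|\mathrm{LCS}(x,x')|$ is the length of a longest common subsequence. For $0<\delta<1$ and $x\in\{0,1\}^n$, a trace from $\mathrm{Del}_\delta(x)$ is obtained by deleting each bit of $x$ independently with probability $\delta$ and concatenating the surviving bits. Theorem. For all constants $0<c<1$ and $K>0$ there is a constant $C>0$, depending only on $c$ and $K$, such that the following holds for all integers $n\ge 0$, $M\ge 1$ and all $0<\delta<1$ with $M\le c/\delta$ and $M\le K\ln(n+1)$. Let $x$ be uniform over $\{0,1\}^n$, let $y^{(1)},\dots,y^{(M)}$ be independent traces drawn from $\mathrm{Del}_\delta(x)$, and let $A$ be any (possibly randomized) algorithm, with no restriction on its running time or computability, which given $\delta$ and $y^{(1)},\dots,y^{(M)}$ outputs a hypothesis string $\hat x\in\{0,1\}^*$. Then $$\mathbb{E}\bigl[d_{\mathrm{edit}}(\hat x,x)\bigr]\ \ge\ n\cdot(\delta M)^{C M}.$$ -/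

import Mathlib

open scoped ENNReal

namespace TraceReconstruction

noncomputable section

/-- Length of a longest common subsequence of two binary strings. The set is nonempty and
bounded, so the supremum is a maximum. -/
def lcsLength (x y : List Bool) : ℕ :=
  sSup {k : ℕ | ∃ w : List Bool, w.Sublist x ∧ w.Sublist y ∧ w.length = k}

/-- Edit distance (insertions and deletions): `|x| + |y| - 2 |LCS(x, y)|`. The natural subtraction
never truncates, see `two_mul_lcsLength_le`. -/
def editDist (x y : List Bool) : ℕ :=
  x.length + y.length - 2 * lcsLength x y

theorem lcsLength_le_left (x y : List Bool) : lcsLength x y ≤ x.length := by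
  refine csSup_le ⟨0, [], List.nil_sublist _, List.nil_sublist _, rfl⟩ ?_
  rintro k ⟨w, hx, _, rfl⟩
  exact hx.length_le

theorem lcsLength_le_right (x y : List Bool) : lcsLength x y ≤ y.length := by
  refine csSup_le ⟨0, [], List.nil_sublist _, List.nil_sublist _, rfl⟩ ?_
  rintro k ⟨w, _, hy, rfl⟩
  exact hy.length_le

theorem two_mul_lcsLength_le (x y : List Bool) :
    2 * lcsLength x y ≤ x.length + y.length := by
  have h1 := lcsLength_le_left x y
  have h2 := lcsLength_le_right x y
  omega

/-- The law of `k` independent draws from `p`. -/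
def iid {α : Type} (p : PMF α) : (k : ℕ) → PMF (Fin k → α)
  | 0 => PMF.pure Fin.elim0
  | k + 1 => p.bind fun a => (iid p k).bind fun f => PMF.pure (Fin.cons a f)

/-- `iid p k` is the product distribution. -/
theorem iid_apply {α : Type} (p : PMF α) (k : ℕ) (f : Fin k → α) :
    iid p k f = ∏ i, p (f i) := by
  induction k with
  | zero =>
    have h : f = Fin.elim0 := Subsingleton.elim _ _
    simp [iid, PMF.pure_apply, h]
  | succ k ih =>
    have key : ∀ (a : α) (g : Fin k → α),
        f = Fin.cons a g ↔ f 0 = a ∧ Fin.tail f = g := by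
      intro a g
      constructor
      · rintro rfl
        simp
      · rintro ⟨rfl, rfl⟩
        simp
    rw [iid, PMF.bind_apply, tsum_eq_single (f 0), PMF.bind_apply, tsum_eq_single (Fin.tail f)]
    · rw [PMF.pure_apply, if_pos ((key _ _).2 ⟨rfl, rfl⟩), ih, Fin.prod_univ_succ, mul_one]
      rfl
    · intro g hg
      rw [PMF.pure_apply, if_neg (fun h => hg ((key _ _).1 h).2.symm), mul_zero]
    · intro a ha
      rw [PMF.bind_apply]
      simp only [PMF.pure_apply]
      rw [ENNReal.tsum_eq_zero.2, mul_zero]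
      intro g
      rw [if_neg (fun h => ha ((key _ _).1 h).1.symm), mul_zero]

/-- A biased coin: `true` with probability `δ`, `false` with probability `1 - δ`. -/
def coin (δ : unitInterval) : PMF Bool :=
  PMF.ofFintype (fun b => ENNReal.ofReal (if b then (δ : ℝ) else 1 - (δ : ℝ))) (by
    rw [Fintype.sum_bool, if_pos rfl, if_neg (by decide),
      ← ENNReal.ofReal_add δ.2.1 (sub_nonneg.2 δ.2.2)]
    simp)

/-- The subword of `x` formed by the positions that are not deleted, in their order;
`D i = true` means that position `i` is deleted. -/
def survivors {n : ℕ} (x D : Fin n → Bool) : List Bool :=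
  ((List.finRange n).filter fun i => !D i).map x

/-- The deletion channel: every position of `x` is deleted independently with probability `δ`
and the surviving bits are concatenated. -/
def del {n : ℕ} (δ : unitInterval) (x : Fin n → Bool) : PMF (List Bool) :=
  (iid (coin δ) n).map (survivors x)

/-- A (possibly randomized) reconstruction procedure from `M` traces: it receives the deletion rate
and the traces and outputs a random hypothesis string. There is no computability or running-time
restriction; deterministic procedures are those whose values are point masses. -/
abbrev Algorithm (M : ℕ) : Type :=
  unitInterval → (Fin M → List Bool) → PMF (List Bool)

/-- Joint law of the source string, uniform over `{0,1}^n`, and the hypothesis that `A` outputs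
when it is run on `M` independent traces of the source string. -/
def jointLaw (n M : ℕ) (δ : unitInterval) (A : Algorithm M) :
    PMF ((Fin n → Bool) × List Bool) :=
  (PMF.uniformOfFintype (Fin n → Bool)).bind fun x =>
    (iid (del δ x) M).bind fun y =>
      (A δ y).map fun w => (x, w)

/-- Expected edit distance between the hypothesis of `A` and the source string, a value
in `[0, ∞]`. -/
def expectedEditDist (n M : ℕ) (δ : unitInterval) (A : Algorithm M) : ℝ≥0∞ :=
  ∑' p : (Fin n → Bool) × List Bool,
    jointLaw n M δ A p * (editDist p.2 (List.ofFn p.1) : ℝ≥0∞)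

end

end TraceReconstruction

/-!
The proof is an entropy argument with local ambiguities. Cut the source string into blocks of length
`2 * (L + 1)`, with `L + 1` of order `M`. Call a block ambiguous if it is not a palindrome although
the part of each trace that comes from it is one. Reversing an ambiguous block, together with the
deletion patterns on it, changes the source but neither the traces nor the probability, so that,
given the traces, each ambiguous block carries one bit of entropy. A block equal to `0^L 1 0^(L+1)`
that loses exactly one letter of its last run in each trace is ambiguous: both this block and its
reversal leave `0^L 1 0^L`. As the run has length of order `M`, this has probability at least
`(a * δ * M) ^ M` for a constant `a` (`le_sum_weight_mem_ambiguousBlocks`, `pow_le_ambiguity`).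

On the other hand, a hypothesis `w` close to the source describes it well: for `t ≤ 1 / 4` the sum
of `t ^ editDist w x` over all `x` of length `n` is at most `(1 + 4 * t) ^ n`
(`sum_pow_editDist_le`), so that `t ^ editDist w x / exp (4 * t * n)` is a subprobability in `x`.
The Gibbs inequality compares it with the posterior law of the source and gives
`E|T| * log 2 ≤ E[editDist] * log (1 / t) + 4 * t * n`, where `T` is the set of ambiguous blocks
(`sum_card_ambiguousBlocks_le`). No concentration of `|T|` is needed, and no independence between
blocks. With `t` a small multiple of the density of ambiguous blocks, the expected edit distance is
at least `n * (2 * t) ^ 2`, and since `δ * M ≤ c < 1` the constant `a` is absorbed by the exponent.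
-/

open scoped ENNReal

namespace TraceReconstruction

/-! ### Expectations and the law of the traces -/

/-- Expectation of a `[0, ∞]`-valued function under a discrete distribution. -/
noncomputable def expect {α : Type*} (μ : PMF α) (g : α → ℝ≥0∞) : ℝ≥0∞ := ∑' a, μ a * g a

theorem expect_bind {α β : Type*} (μ : PMF α) (f : α → PMF β) (g : β → ℝ≥0∞) :
    expect (μ.bind f) g = expect μ fun a => expect (f a) g := by
  simp only [expect, PMF.bind_apply, ← ENNReal.tsum_mul_left, ← ENNReal.tsum_mul_right]
  rw [ENNReal.tsum_comm]
  simp only [mul_assoc]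

theorem expect_pure {α : Type*} (a : α) (g : α → ℝ≥0∞) : expect (PMF.pure a) g = g a := by
  rw [expect, tsum_eq_single a]
  · simp
  · intro b hb
    simp [PMF.pure_apply, hb]

theorem expect_map {α β : Type*} (μ : PMF α) (f : α → β) (g : β → ℝ≥0∞) :
    expect (μ.map f) g = expect μ fun a => g (f a) := by
  rw [← PMF.bind_pure_comp, expect_bind]
  simp only [Function.comp_apply, expect_pure]

theorem expect_mono {α : Type*} (μ : PMF α) {f g : α → ℝ≥0∞} (h : ∀ a, f a ≤ g a) :
    expect μ f ≤ expect μ g :=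
  ENNReal.tsum_le_tsum fun a => mul_le_mul_right (h a) _

theorem expect_add {α : Type*} (μ : PMF α) (f g : α → ℝ≥0∞) :
    expect μ (fun a => f a + g a) = expect μ f + expect μ g := by
  simp only [expect, mul_add, ENNReal.tsum_add]

theorem expect_mul_left {α : Type*} (μ : PMF α) (c : ℝ≥0∞) (f : α → ℝ≥0∞) :
    expect μ (fun a => c * f a) = c * expect μ f := by
  simp only [expect, ← ENNReal.tsum_mul_left, mul_left_comm]

theorem expect_const {α : Type*} (μ : PMF α) (c : ℝ≥0∞) : expect μ (fun _ => c) = c := by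
  rw [expect, ENNReal.tsum_mul_right, μ.tsum_coe, one_mul]

theorem sum_expect {α ι : Type*} (μ : PMF α) (s : Finset ι) (f : ι → α → ℝ≥0∞) :
    ∑ i ∈ s, expect μ (f i) = expect μ fun a => ∑ i ∈ s, f i a := by
  simp only [expect, Finset.mul_sum]
  exact (Summable.tsum_finsetSum fun _ _ => ENNReal.summable).symm

theorem iid_map {α β : Type} (p : PMF α) (f : α → β) (k : ℕ) :
    iid (p.map f) k = (iid p k).map fun g i => f (g i) := by
  induction k with
  | zero =>
    simp only [iid, PMF.pure_map]
    congr 1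
    exact Subsingleton.elim _ _
  | succ k ih =>
    simp only [iid, PMF.map_bind, PMF.bind_map, PMF.pure_map, ih, Function.comp_def]
    congr 1; funext a; congr 1; funext g; congr 1; funext i
    refine Fin.cases ?_ (fun j => ?_) i <;> simp

/-- Probability of a source string together with a family of deletion patterns. -/
noncomputable def weight (n M : ℕ) (δ : unitInterval)
    (ω : (Fin n → Bool) × (Fin M → Fin n → Bool)) : ℝ≥0∞ :=
  (∏ _j : Fin n, 2⁻¹) * ∏ i, ∏ j, coin δ (ω.2 i j)

/-- The traces produced by a source string and a family of deletion patterns. -/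
def traces {n M : ℕ} (ω : (Fin n → Bool) × (Fin M → Fin n → Bool)) : Fin M → List Bool :=
  fun i => survivors ω.1 (ω.2 i)

/-- The expected edit distance as a finite sum over source strings and deletion patterns, where only
the output of the algorithm ranges over an infinite set. -/
theorem expectedEditDist_eq (n M : ℕ) (δ : unitInterval) (A : Algorithm M) :
    expectedEditDist n M δ A = ∑ ω : (Fin n → Bool) × (Fin M → Fin n → Bool),
      weight n M δ ω *
        expect (A δ (traces ω)) fun w => (editDist w (List.ofFn ω.1) : ℝ≥0∞) := by
  have h : expectedEditDist n M δ A =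
      expect (jointLaw n M δ A) fun p => (editDist p.2 (List.ofFn p.1) : ℝ≥0∞) := rfl
  have hd : ∀ x : Fin n → Bool, del δ x = (iid (coin δ) n).map (survivors x) := fun _ => rfl
  rw [h, jointLaw]
  simp only [expect_bind, expect_map, hd, iid_map]
  rw [Fintype.sum_prod_type, expect, tsum_fintype]
  refine Finset.sum_congr rfl fun x _ => ?_
  rw [expect, tsum_fintype, Finset.mul_sum]
  refine Finset.sum_congr rfl fun D _ => ?_
  rw [← mul_assoc]
  congr 1
  simp only [weight, iid_apply, PMF.uniformOfFintype_apply]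
  congr 1
  simp [ENNReal.inv_pow]

theorem coin_sum (δ : unitInterval) : ∑ b, coin δ b = 1 := by
  have := (coin δ).tsum_coe
  rwa [tsum_fintype] at this

theorem sum_prod_apply_eq_one {κ : Type*} [Fintype κ] [DecidableEq κ] {V : Type*} [Fintype V]
    (q : κ → V → ℝ≥0∞) (hq : ∀ k, ∑ v, q k v = 1) : ∑ f : κ → V, ∏ k, q k (f k) = 1 := by
  have := Finset.prod_univ_sum (fun _ : κ => (Finset.univ : Finset V)) q
  rw [Fintype.piFinset_univ] at this
  rw [← this]
  simp [hq]

theorem sum_weight (n M : ℕ) (δ : unitInterval) : ∑ ω, weight n M δ ω = 1 := by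
  have h1 : ∑ _x : Fin n → Bool, ∏ _j : Fin n, (2⁻¹ : ℝ≥0∞) = 1 :=
    sum_prod_apply_eq_one (fun _ : Fin n => fun _ : Bool => (2⁻¹ : ℝ≥0∞))
      fun _ => by rw [Fintype.sum_bool, ENNReal.inv_two_add_inv_two]
  have h2 : ∑ D : Fin M → Fin n → Bool, ∏ i, ∏ j, coin δ (D i j) = 1 :=
    sum_prod_apply_eq_one (fun _ : Fin M => fun D : Fin n → Bool => ∏ j, coin δ (D j)) fun _ =>
      sum_prod_apply_eq_one (fun _ : Fin n => fun b : Bool => coin δ b) fun _ => coin_sum δ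
  simp only [weight]
  rw [Fintype.sum_prod_type]
  dsimp only
  rw [← Finset.sum_mul_sum, h1, h2, one_mul]

/-! ### Edit distance and its exponential sums -/

theorem exists_common_sublist (x y : List Bool) :
    ∃ w : List Bool, w.Sublist x ∧ w.Sublist y ∧ w.length = lcsLength x y := by
  have hne : {k : ℕ | ∃ w : List Bool, w.Sublist x ∧ w.Sublist y ∧ w.length = k}.Nonempty :=
    ⟨0, [], List.nil_sublist _, List.nil_sublist _, rfl⟩
  refine Nat.sSup_mem hne ⟨x.length, ?_⟩
  rintro k ⟨w, hx, _, rfl⟩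
  exact hx.length_le

theorem length_le_lcsLength {w x y : List Bool} (hx : w.Sublist x) (hy : w.Sublist y) :
    w.length ≤ lcsLength x y := by
  refine le_csSup ⟨x.length, ?_⟩ ⟨w, hx, hy, rfl⟩
  rintro k ⟨w, hx, _, rfl⟩
  exact hx.length_le

theorem editDist_nil_left (y : List Bool) : editDist [] y = y.length := by
  have := lcsLength_le_left [] y
  simp only [editDist, List.length_nil] at *
  omega

theorem editDist_nil_right (x : List Bool) : editDist x [] = x.length := by
  have := lcsLength_le_right x []
  simp only [editDist, List.length_nil] at *
  omega

theorem eq_of_editDist_eq_zero {x y : List Bool} (h : editDist x y = 0) : x = y := by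
  obtain ⟨w, hx, hy, hw⟩ := exists_common_sublist x y
  have h1 := lcsLength_le_left x y
  have h2 := lcsLength_le_right x y
  simp only [editDist] at h
  rw [← hx.eq_of_length (by omega), ← hy.eq_of_length (by omega)]

/-- An optimal alignment of two nonempty strings deletes the first letter of one of them or matches
the two first letters. -/
theorem editDist_cons_cons (a b : Bool) (w y : List Bool) :
    editDist w (b :: y) + 1 ≤ editDist (a :: w) (b :: y) ∨
    editDist (a :: w) y + 1 ≤ editDist (a :: w) (b :: y) ∨
    (a = b ∧ editDist w y ≤ editDist (a :: w) (b :: y)) := by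
  have h1 := two_mul_lcsLength_le w (b :: y)
  have h2 := two_mul_lcsLength_le (a :: w) y
  have h3 := two_mul_lcsLength_le w y
  have h4 := two_mul_lcsLength_le (a :: w) (b :: y)
  obtain ⟨v, hx, hy, hv⟩ := exists_common_sublist (a :: w) (b :: y)
  simp only [editDist, List.length_cons] at *
  cases hx with
  | cons _ hx =>
    have := length_le_lcsLength hx hy
    left; omega
  | cons_cons _ hx =>
    rename_i v
    cases hy with
    | cons _ hy =>
      have := length_le_lcsLength (hx.cons_cons a) hy
      right; left; omega
    | cons_cons _ hy =>
      have := length_le_lcsLength hx hy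
      simp only [List.length_cons] at hv
      right; right; exact ⟨rfl, by omega⟩

theorem sum_ofFn_succ (n : ℕ) (f : List Bool → ℝ) :
    ∑ x : Fin (n + 1) → Bool, f (List.ofFn x) =
      ∑ x : Fin n → Bool, ∑ b : Bool, f (b :: List.ofFn x) := by
  rw [Finset.sum_comm, ← Fintype.sum_prod_type']
  refine (Fintype.sum_equiv (Fin.consEquiv fun _ => Bool) _ _ fun p => ?_).symm
  simp [Fin.consEquiv, List.ofFn_succ]

/-- The binary strings of a given length are few near any string `w`: unrolling an optimal
alignment letter by letter multiplies the sum by at most `(1 + 2 * t) / (1 - t)` for each letter of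
`x`, whatever the length of `w`. -/
theorem sum_pow_editDist_le {t : ℝ} (ht : 0 ≤ t) (ht' : t ≤ 1 / 4) (n : ℕ) (w : List Bool) :
    ∑ x : Fin n → Bool, t ^ editDist w (List.ofFn x) ≤ (1 + 4 * t) ^ n := by
  induction n generalizing w with
  | zero =>
    simp only [List.ofFn_zero, editDist_nil_right]
    simpa using pow_le_one₀ ht (by linarith)
  | succ n ihn =>
    induction w with
    | nil =>
      simp only [editDist_nil_left, List.length_ofFn]
      simp only [Finset.sum_const, Finset.card_univ, Fintype.card_fun, Fintype.card_bool,
        Fintype.card_fin, nsmul_eq_mul]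
      push_cast
      rw [← mul_pow]
      exact pow_le_pow_left₀ (by linarith) (by linarith) _
    | cons a w ihw =>
      have hpow : ∀ {i j : ℕ}, i ≤ j → t ^ j ≤ t ^ i := fun h =>
        pow_le_pow_of_le_one ht (by linarith) h
      have step : ∀ (b : Bool) (y : List Bool), t ^ editDist (a :: w) (b :: y) ≤
          t * t ^ editDist w (b :: y) + t * t ^ editDist (a :: w) y +
            if a = b then t ^ editDist w y else 0 := by
        intro b y
        have p1 : 0 ≤ t * t ^ editDist w (b :: y) := by positivity
        have p2 : 0 ≤ t * t ^ editDist (a :: w) y := by positivity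
        have p3 : 0 ≤ (if a = b then t ^ editDist w y else 0) := by positivity
        rcases editDist_cons_cons a b w y with h | h | ⟨hab, h⟩
        · have := hpow h
          rw [pow_succ'] at this
          linarith
        · have := hpow h
          rw [pow_succ'] at this
          linarith
        · have := hpow h
          rw [if_pos hab] at *
          linarith
      have e1 := ihw
      rw [sum_ofFn_succ n fun y => t ^ editDist w y] at e1
      have e2 := ihn (a :: w)
      have e3 := ihn w
      rw [sum_ofFn_succ n fun y => t ^ editDist (a :: w) y]
      calc ∑ x : Fin n → Bool, ∑ b : Bool, t ^ editDist (a :: w) (b :: List.ofFn x)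
          ≤ ∑ x : Fin n → Bool, ∑ b : Bool, (t * t ^ editDist w (b :: List.ofFn x) +
              t * t ^ editDist (a :: w) (List.ofFn x) +
              if a = b then t ^ editDist w (List.ofFn x) else 0) :=
            Finset.sum_le_sum fun x _ => Finset.sum_le_sum fun b _ => step b _
        _ = t * (∑ x : Fin n → Bool, ∑ b : Bool, t ^ editDist w (b :: List.ofFn x)) +
              2 * t * (∑ x : Fin n → Bool, t ^ editDist (a :: w) (List.ofFn x)) +
              ∑ x : Fin n → Bool, t ^ editDist w (List.ofFn x) := by
            simp only [Finset.mul_sum, ← Finset.sum_add_distrib]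
            refine Finset.sum_congr rfl fun x _ => ?_
            cases a <;> simp <;> ring
        _ ≤ t * (1 + 4 * t) ^ (n + 1) + 2 * t * (1 + 4 * t) ^ n + (1 + 4 * t) ^ n := by
            gcongr
        _ = (t * (1 + 4 * t) + 2 * t + 1) * (1 + 4 * t) ^ n := by ring
        _ ≤ (1 + 4 * t) * (1 + 4 * t) ^ n := by
            refine mul_le_mul_of_nonneg_right ?_ (by positivity)
            nlinarith
        _ = (1 + 4 * t) ^ (n + 1) := by ring

/-! ### Counting sources through involutions -/

/-- Suppose that the permutations `move S` preserve the weight and `T`, and that for the `S ⊆ T ω`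
they do not change `Q` at `ω`, while different such `S` move `ω` to different values of `X`.
Then every family of subprobabilities `Q ω` is small at `X ω` by a factor `2 ^ |T ω|` on average. -/
theorem sum_weight_two_pow_le {Ω 𝒳 ι : Type*} [Fintype Ω] [Fintype 𝒳] [DecidableEq ι]
    [Fintype ι] (W : Ω → ℝ≥0∞) (X : Ω → 𝒳) (T : Ω → Finset ι) (move : Finset ι → Equiv.Perm Ω)
    (Q : Ω → 𝒳 → ℝ≥0∞) (hW : ∀ S ω, W (move S ω) = W ω) (hT : ∀ S ω, T (move S ω) = T ω)
    (hQ : ∀ S ω, S ⊆ T ω → Q (move S ω) = Q ω) (hsum : ∀ ω, ∑ x, Q ω x ≤ 1)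
    (hinj : ∀ ω S S', S ⊆ T ω → S' ⊆ T ω → X (move S ω) = X (move S' ω) → S = S') :
    ∑ ω, W ω * (2 ^ (T ω).card * Q ω (X ω)) ≤ ∑ ω, W ω := by
  classical
  calc ∑ ω, W ω * (2 ^ (T ω).card * Q ω (X ω))
      = ∑ ω, ∑ S : Finset ι, if S ⊆ T ω then W ω * Q ω (X ω) else 0 := by
        refine Finset.sum_congr rfl fun ω _ => ?_
        rw [← Finset.sum_filter, Finset.sum_const, nsmul_eq_mul,
          show Finset.univ.filter (fun S => S ⊆ T ω) = (T ω).powerset by ext; simp,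
          Finset.card_powerset]
        push_cast
        ring
    _ = ∑ S : Finset ι, ∑ ω, if S ⊆ T ω then W ω * Q ω (X ω) else 0 := Finset.sum_comm
    _ = ∑ S : Finset ι, ∑ ω, if S ⊆ T ω then W ω * Q ω (X (move S ω)) else 0 := by
        refine Finset.sum_congr rfl fun S _ => ?_
        rw [← Equiv.sum_comp (move S)]
        refine Finset.sum_congr rfl fun ω _ => ?_
        rw [hT, hW]
        split_ifs with h
        · rw [hQ S ω h]
        · rfl
    _ = ∑ ω, ∑ S : Finset ι, if S ⊆ T ω then W ω * Q ω (X (move S ω)) else 0 := Finset.sum_comm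
    _ ≤ ∑ ω, W ω := by
        refine Finset.sum_le_sum fun ω _ => ?_
        rw [← Finset.sum_filter, ← Finset.mul_sum]
        have h : ∑ S with S ⊆ T ω, Q ω (X (move S ω)) ≤ 1 := by
          rw [← Finset.sum_image (f := Q ω) (g := fun S => X (move S ω))]
          · exact (Finset.sum_le_sum_of_subset (Finset.subset_univ _)).trans (hsum ω)
          · intro S hS S' hS' h
            simp only [Finset.coe_filter, Finset.mem_univ, true_and, Set.mem_ofPred_eq] at hS hS'
            exact hinj ω S S' hS hS' h
        calc _ ≤ W ω * 1 := by gcongr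
          _ = W ω := mul_one _

/-! ### Survivors of blocks -/

theorem survivors_eq_ofFn {n : ℕ} (x D : Fin n → Bool) :
    survivors x D = ((List.ofFn fun i => (x i, D i)).filter fun p => !p.2).map Prod.fst := by
  rw [survivors, List.ofFn_eq_map, List.filter_map, List.map_map]
  rfl

theorem survivors_add {a b : ℕ} (x D : Fin (a + b) → Bool) :
    survivors x D = survivors (fun i => x (Fin.castAdd b i)) (fun i => D (Fin.castAdd b i)) ++
      survivors (fun i => x (Fin.natAdd a i)) fun i => D (Fin.natAdd a i) := by
  simp only [survivors_eq_ofFn, List.ofFn_add, List.filter_append, List.map_append]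
  rfl

theorem survivors_mul {m l : ℕ} (x D : Fin (m * l) → Bool) :
    survivors x D = (List.ofFn fun b : Fin m =>
      survivors (fun j => x (finProdFinEquiv (b, j)))
        fun j => D (finProdFinEquiv (b, j))).flatten := by
  have h : ∀ (b : Fin m) (j : Fin l) (h : (b : ℕ) * l + j < m * l),
      (⟨b * l + j, h⟩ : Fin (m * l)) = finProdFinEquiv (b, j) := by
    intro b j h
    ext
    simp [finProdFinEquiv, mul_comm, add_comm]
  simp only [survivors_eq_ofFn, List.ofFn_mul, h, List.filter_flatten, List.map_flatten,
    List.map_ofFn]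
  rfl

theorem survivors_rev {l : ℕ} (x D : Fin l → Bool) :
    survivors (fun j => x j.rev) (fun j => D j.rev) = (survivors x D).reverse := by
  rw [survivors, survivors, ← List.map_reverse, ← List.filter_reverse, List.finRange_reverse,
    List.filter_map, List.map_map]
  rfl

/-! ### Reversing blocks -/

/-- Positions `Fin (m * l + r)` cut into `m` blocks of length `l` and a tail of length `r`. -/
def blockEquiv (m l r : ℕ) : (Fin m × Fin l) ⊕ Fin r ≃ Fin (m * l + r) :=
  (Equiv.sumCongr finProdFinEquiv (Equiv.refl _)).trans finSumFinEquiv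

/-- The `j`-th position of the block `b`. -/
def blockPos {m l : ℕ} (r : ℕ) (b : Fin m) (j : Fin l) : Fin (m * l + r) :=
  blockEquiv m l r (Sum.inl (b, j))

theorem blockPos_injective {m l : ℕ} (r : ℕ) (b : Fin m) :
    Function.Injective (blockPos (l := l) r b) := by
  intro j j' h
  simpa [blockPos] using h

theorem survivors_blocks {m l r : ℕ} (x D : Fin (m * l + r) → Bool) :
    survivors x D = (List.ofFn fun b : Fin m =>
      survivors (fun j : Fin l => x (blockPos r b j)) fun j => D (blockPos r b j)).flatten ++
        survivors (fun i => x (blockEquiv m l r (Sum.inr i)))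
          fun i => D (blockEquiv m l r (Sum.inr i)) := by
  rw [survivors_add, survivors_mul]
  rfl

/-- The permutation of the positions that reverses each block of `S`. -/
def blockRev {m : ℕ} (l r : ℕ) (S : Finset (Fin m)) : Equiv.Perm (Fin (m * l + r)) :=
  (blockEquiv m l r).permCongr <| Equiv.sumCongr
    (Equiv.prodShear (Equiv.refl _) fun b => if b ∈ S then Fin.revPerm else Equiv.refl _)
    (Equiv.refl _)

theorem blockRev_blockPos_of_mem {m l r : ℕ} {S : Finset (Fin m)} {b : Fin m} (hb : b ∈ S)
    (j : Fin l) : blockRev l r S (blockPos r b j) = blockPos r b j.rev := by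
  simp [blockRev, blockPos, hb, Equiv.permCongr_apply, Equiv.prodShear]

theorem blockRev_blockPos_of_notMem {m l r : ℕ} {S : Finset (Fin m)} {b : Fin m} (hb : b ∉ S)
    (j : Fin l) : blockRev l r S (blockPos r b j) = blockPos r b j := by
  simp [blockRev, blockPos, hb, Equiv.permCongr_apply, Equiv.prodShear]

theorem blockRev_tail {m l r : ℕ} (S : Finset (Fin m)) (i : Fin r) :
    blockRev l r S (blockEquiv m l r (Sum.inr i)) = blockEquiv m l r (Sum.inr i) := by
  simp [blockRev, Equiv.permCongr_apply]

/-- Reverse the blocks of `S` in the source string and in each of the deletion patterns. -/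
def reverseBlocks {m : ℕ} (l r M : ℕ) (S : Finset (Fin m)) :
    Equiv.Perm ((Fin (m * l + r) → Bool) × (Fin M → Fin (m * l + r) → Bool)) :=
  Equiv.prodCongr ((blockRev l r S).symm.arrowCongr (Equiv.refl _))
    (Equiv.piCongrRight fun _ => (blockRev l r S).symm.arrowCongr (Equiv.refl _))

theorem reverseBlocks_fst {m l r M : ℕ} (S : Finset (Fin m))
    (ω : (Fin (m * l + r) → Bool) × (Fin M → Fin (m * l + r) → Bool)) (i : Fin (m * l + r)) :
    (reverseBlocks l r M S ω).1 i = ω.1 (blockRev l r S i) := rfl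

theorem reverseBlocks_snd {m l r M : ℕ} (S : Finset (Fin m))
    (ω : (Fin (m * l + r) → Bool) × (Fin M → Fin (m * l + r) → Bool)) (t : Fin M)
    (i : Fin (m * l + r)) : (reverseBlocks l r M S ω).2 t i = ω.2 t (blockRev l r S i) := rfl

theorem weight_reverseBlocks {m l r M : ℕ} (δ : unitInterval) (S : Finset (Fin m))
    (ω : (Fin (m * l + r) → Bool) × (Fin M → Fin (m * l + r) → Bool)) :
    weight _ M δ (reverseBlocks l r M S ω) = weight _ M δ ω := by
  simp only [weight, reverseBlocks_snd]
  congr 1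
  exact Finset.prod_congr rfl fun t _ =>
    Equiv.prod_comp (blockRev l r S) fun j => coin δ (ω.2 t j)

/-- The part of the trace number `t` that comes from the block `b`. -/
def blockTrace {m l r M : ℕ} (ω : (Fin (m * l + r) → Bool) × (Fin M → Fin (m * l + r) → Bool))
    (b : Fin m) (t : Fin M) : List Bool :=
  survivors (fun j : Fin l => ω.1 (blockPos r b j)) fun j => ω.2 t (blockPos r b j)

theorem blockTrace_reverseBlocks {m l r M : ℕ} (S : Finset (Fin m))
    (ω : (Fin (m * l + r) → Bool) × (Fin M → Fin (m * l + r) → Bool)) (b : Fin m) (t : Fin M) :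
    blockTrace (reverseBlocks l r M S ω) b t =
      if b ∈ S then (blockTrace ω b t).reverse else blockTrace ω b t := by
  split_ifs with hb
  · simp only [blockTrace, reverseBlocks_fst, reverseBlocks_snd, blockRev_blockPos_of_mem hb]
    exact survivors_rev (fun j => ω.1 (blockPos r b j)) fun j => ω.2 t (blockPos r b j)
  · simp only [blockTrace, reverseBlocks_fst, reverseBlocks_snd, blockRev_blockPos_of_notMem hb]

/-- The ambiguous blocks: those that are not palindromes in the source string, although all their
traces are. -/
def ambiguousBlocks {m l r M : ℕ}
    (ω : (Fin (m * l + r) → Bool) × (Fin M → Fin (m * l + r) → Bool)) : Finset (Fin m) :=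
  {b | (∃ j : Fin l, ω.1 (blockPos r b j.rev) ≠ ω.1 (blockPos r b j)) ∧
    ∀ t, (blockTrace ω b t).reverse = blockTrace ω b t}

theorem mem_ambiguousBlocks {m l r M : ℕ}
    {ω : (Fin (m * l + r) → Bool) × (Fin M → Fin (m * l + r) → Bool)} {b : Fin m} :
    b ∈ ambiguousBlocks ω ↔ (∃ j : Fin l, ω.1 (blockPos r b j.rev) ≠ ω.1 (blockPos r b j)) ∧
      ∀ t, (blockTrace ω b t).reverse = blockTrace ω b t := by
  simp [ambiguousBlocks]

theorem ambiguousBlocks_reverseBlocks {m l r M : ℕ} (S : Finset (Fin m))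
    (ω : (Fin (m * l + r) → Bool) × (Fin M → Fin (m * l + r) → Bool)) :
    ambiguousBlocks (reverseBlocks l r M S ω) = ambiguousBlocks ω := by
  ext b
  simp only [mem_ambiguousBlocks, blockTrace_reverseBlocks, reverseBlocks_fst]
  by_cases hb : b ∈ S
  · simp only [hb, blockRev_blockPos_of_mem, if_true, List.reverse_reverse, Fin.rev_rev]
    simp only [ne_comm, eq_comm]
  · simp only [hb, blockRev_blockPos_of_notMem, if_false, not_false_eq_true]

theorem traces_reverseBlocks {m l r M : ℕ} {S : Finset (Fin m)}
    {ω : (Fin (m * l + r) → Bool) × (Fin M → Fin (m * l + r) → Bool)}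
    (hS : S ⊆ ambiguousBlocks ω) : traces (reverseBlocks l r M S ω) = traces ω := by
  funext t
  have h : ∀ b, blockTrace (reverseBlocks l r M S ω) b t = blockTrace ω b t := by
    intro b
    rw [blockTrace_reverseBlocks]
    split_ifs with hb
    · exact (mem_ambiguousBlocks.1 (hS hb)).2 t
    · rfl
  simp only [blockTrace] at h
  simp only [traces]
  rw [survivors_blocks, survivors_blocks ω.1]
  simp only [h]
  simp only [reverseBlocks_fst, reverseBlocks_snd, blockRev_tail]

theorem reverseBlocks_injOn {m l r M : ℕ} {S S' : Finset (Fin m)}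
    {ω : (Fin (m * l + r) → Bool) × (Fin M → Fin (m * l + r) → Bool)}
    (hS : S ⊆ ambiguousBlocks ω) (hS' : S' ⊆ ambiguousBlocks ω)
    (h : (reverseBlocks l r M S ω).1 = (reverseBlocks l r M S' ω).1) : S = S' := by
  have key : ∀ b j, ω.1 (blockRev l r S (blockPos r b j)) =
      ω.1 (blockRev l r S' (blockPos r b j)) := fun b j => congrFun h (blockPos r b j)
  ext b
  by_cases hb : b ∈ S <;> by_cases hb' : b ∈ S'
  · simp [hb, hb']
  · obtain ⟨j, hj⟩ := (mem_ambiguousBlocks.1 (hS hb)).1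
    have := key b j
    rw [blockRev_blockPos_of_mem hb, blockRev_blockPos_of_notMem hb'] at this
    exact absurd this hj
  · obtain ⟨j, hj⟩ := (mem_ambiguousBlocks.1 (hS' hb')).1
    have := key b j
    rw [blockRev_blockPos_of_notMem hb, blockRev_blockPos_of_mem hb'] at this
    exact absurd this.symm hj
  · simp [hb, hb']

/-! ### The entropy inequality -/

/-- The Gibbs inequality in pointwise form: `log z ≤ z - 1` at `z = 2 ^ T * t ^ d / exp a`. -/
theorem one_add_mul_log_two_le {t a : ℝ} (ht : 0 < t) (ht' : t ≤ 1 / 4) (ha : 0 ≤ a) (d T : ℕ) :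
    1 + (T : ℝ≥0∞) * ENNReal.ofReal (Real.log 2) ≤
      ENNReal.ofReal (Real.log (1 / t)) * d + ENNReal.ofReal a +
        2 ^ T * ENNReal.ofReal (t ^ d / Real.exp a) := by
  have h2 : 0 ≤ Real.log 2 := Real.log_nonneg (by norm_num)
  have h3 : 0 ≤ Real.log (1 / t) := Real.log_nonneg (by rw [le_div_iff₀ ht]; linarith)
  have h4 : 0 ≤ t ^ d / Real.exp a := by positivity
  have key := Real.log_le_sub_one_of_pos (show 0 < 2 ^ T * (t ^ d / Real.exp a) by positivity)
  rw [Real.log_mul (by positivity) (by positivity), Real.log_div (by positivity) (by positivity),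
    Real.log_exp, Real.log_pow, Real.log_pow] at key
  have h5 : Real.log (1 / t) = -Real.log t := by rw [one_div, Real.log_inv]
  calc 1 + (T : ℝ≥0∞) * ENNReal.ofReal (Real.log 2)
      = ENNReal.ofReal (1 + T * Real.log 2) := by
        rw [ENNReal.ofReal_add zero_le_one (by positivity), ENNReal.ofReal_one,
          ENNReal.ofReal_mul (by positivity), ENNReal.ofReal_natCast]
    _ ≤ ENNReal.ofReal (Real.log (1 / t) * d + a + 2 ^ T * (t ^ d / Real.exp a)) := by
        refine ENNReal.ofReal_le_ofReal ?_
        rw [h5]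
        linarith
    _ = _ := by
        rw [ENNReal.ofReal_add (by positivity) (by positivity),
          ENNReal.ofReal_add (by positivity) ha, ENNReal.ofReal_mul h3, ENNReal.ofReal_natCast,
          ENNReal.ofReal_mul (by positivity), ENNReal.ofReal_pow (by norm_num)]
        simp

/-- The expected edit distance is at least the expected number of ambiguous blocks, each of which
carries one bit of entropy given the traces, up to a factor `log (1 / t)` and an error `4 * t` per
source letter. -/
theorem sum_card_ambiguousBlocks_le {m l r M : ℕ} (δ : unitInterval) (A : Algorithm M) {t : ℝ}
    (ht : 0 < t) (ht' : t ≤ 1 / 4) :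
    (∑ ω : (Fin (m * l + r) → Bool) × (Fin M → Fin (m * l + r) → Bool),
      weight _ M δ ω * (ambiguousBlocks ω).card) * ENNReal.ofReal (Real.log 2) ≤
      ENNReal.ofReal (Real.log (1 / t)) * expectedEditDist (m * l + r) M δ A +
        ENNReal.ofReal (4 * t * ((m * l + r : ℕ) : ℝ)) := by
  set n := m * l + r with hn
  set a : ℝ := 4 * t * (n : ℝ) with ha
  have ha0 : 0 ≤ a := by positivity
  set Q : (Fin n → Bool) × (Fin M → Fin n → Bool) → (Fin n → Bool) → ℝ≥0∞ := fun ω x =>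
    expect (A δ (traces ω)) fun w =>
      ENNReal.ofReal (t ^ editDist w (List.ofFn x) / Real.exp a) with hQ
  have hQ1 : ∀ ω, ∑ x, Q ω x ≤ 1 := by
    intro ω
    rw [hQ, sum_expect]
    refine (expect_mono _ fun w => ?_).trans (expect_const _ 1).le
    rw [← ENNReal.ofReal_sum_of_nonneg fun _ _ => by positivity, ← Finset.sum_div,
      ← ENNReal.ofReal_one]
    refine ENNReal.ofReal_le_ofReal ?_
    rw [div_le_one (Real.exp_pos _)]
    refine (sum_pow_editDist_le ht.le ht' n w).trans ?_
    rw [ha, mul_comm (4 * t) (n : ℝ), Real.exp_nat_mul]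
    refine pow_le_pow_left₀ (by positivity) ?_ _
    linarith [Real.add_one_le_exp (4 * t)]
  have hZ := sum_weight_two_pow_le (weight n M δ) Prod.fst ambiguousBlocks
    (reverseBlocks l r M) Q (weight_reverseBlocks δ) ambiguousBlocks_reverseBlocks
    (fun S ω hS => by simp only [hQ, traces_reverseBlocks hS]) hQ1
    (fun ω S S' hS hS' h => reverseBlocks_injOn hS hS' h)
  rw [sum_weight] at hZ
  have hmain : ∑ ω, weight n M δ ω *
        (1 + ((ambiguousBlocks (m := m) (l := l) (r := r) ω).card : ℝ≥0∞) *
          ENNReal.ofReal (Real.log 2)) ≤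
      ∑ ω, weight n M δ ω * (ENNReal.ofReal (Real.log (1 / t)) *
        expect (A δ (traces ω)) (fun w => (editDist w (List.ofFn ω.1) : ℝ≥0∞)) +
          ENNReal.ofReal a + 2 ^ (ambiguousBlocks (m := m) (l := l) (r := r) ω).card *
            Q ω ω.1) := by
    refine Finset.sum_le_sum fun ω _ => mul_le_mul_right ?_ _
    rw [hQ, ← expect_mul_left, ← expect_mul_left, ← expect_const (A δ (traces ω)) (.ofReal a),
      ← expect_add, ← expect_add]
    conv_lhs => rw [← expect_const (A δ (traces ω)) (1 + _ * _)]
    exact expect_mono _ fun w => one_add_mul_log_two_le ht ht' ha0 _ _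
  simp only [mul_add, Finset.sum_add_distrib, mul_one, sum_weight, ← Finset.sum_mul, one_mul,
    ← mul_assoc] at hmain
  simp only [mul_assoc] at hmain hZ
  have hE : ∑ ω, weight n M δ ω * (ENNReal.ofReal (Real.log (1 / t)) *
      expect (A δ (traces ω)) fun w => (editDist w (List.ofFn ω.1) : ℝ≥0∞)) =
      ENNReal.ofReal (Real.log (1 / t)) * expectedEditDist n M δ A := by
    rw [expectedEditDist_eq, Finset.mul_sum]
    exact Finset.sum_congr rfl fun ω _ => mul_left_comm _ _ _
  rw [hE] at hmain
  have h1 := hmain.trans (add_le_add_right hZ _)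
  rw [add_comm (1 : ℝ≥0∞)] at h1
  exact (ENNReal.add_le_add_iff_right ENNReal.one_ne_top).1 h1

/-! ### The probability that a block is ambiguous -/

/-- The marginal of a product distribution on an injective family of coordinates. -/
theorem sum_prod_ite_comp_eq {n l : ℕ} (q : Bool → ℝ≥0∞) (hq : ∑ v, q v = 1) {p : Fin l → Fin n}
    (hp : Function.Injective p) (g : Fin l → Bool) :
    ∑ f : Fin n → Bool, (if ∀ j, f (p j) = g j then ∏ i, q (f i) else 0) = ∏ j, q (g j) := by
  classical
  have h1 : ∀ f : Fin n → Bool, (if ∀ j, f (p j) = g j then ∏ i, q (f i) else 0) =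
      ∏ i, if ∀ j, p j = i → f i = g j then q (f i) else 0 := by
    intro f
    split_ifs with h
    · refine Finset.prod_congr rfl fun i _ => ?_
      rw [if_pos]
      rintro j rfl
      exact h j
    · push Not at h
      obtain ⟨j, hj⟩ := h
      refine (Finset.prod_eq_zero (Finset.mem_univ (p j)) ?_).symm
      rw [if_neg]
      exact fun h => hj (h j rfl)
  have h2 := Finset.prod_univ_sum (fun _ : Fin n => (Finset.univ : Finset Bool))
    fun i v => if ∀ j, p j = i → v = g j then q v else 0
  rw [Fintype.piFinset_univ] at h2
  simp only [h1]
  rw [← h2, ← Finset.prod_subset (Finset.subset_univ (Finset.univ.image p)),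
    Finset.prod_image fun _ _ _ _ h => hp h]
  · refine Finset.prod_congr rfl fun j _ => ?_
    have : ∀ v, (∀ j', p j' = p j → v = g j') ↔ v = g j := fun v =>
      ⟨fun h => h j rfl, fun h j' hj' => by rw [hp hj', h]⟩
    simp [this]
  · intro i _ hi
    have : ∀ v : Bool, ∀ j, p j = i → v = g j := fun v j hj =>
      absurd (Finset.mem_image.2 ⟨j, Finset.mem_univ _, hj⟩) hi
    calc _ = ∑ v, q v := Finset.sum_congr rfl fun v _ => if_pos (this v)
      _ = 1 := hq

/-- The string `0^L 1 0^(L+1)`. -/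
def offCenter (L : ℕ) (j : Fin (L + 1 + (L + 1))) : Bool := decide ((j : ℕ) = L)

/-- The deletion pattern that deletes only the letter in the position `j` of the second half. -/
def deleteOne (L : ℕ) (j : Fin (L + 1)) (i : Fin (L + 1 + (L + 1))) : Bool :=
  decide (i = Fin.natAdd (L + 1) j)

theorem survivors_false {l : ℕ} (D : Fin l → Bool) :
    survivors (fun _ => false) D = List.replicate (survivors (fun _ => false) D).length false := by
  rw [List.eq_replicate_iff]
  refine ⟨rfl, fun b hb => ?_⟩
  simp only [survivors, List.mem_map] at hb
  obtain ⟨_, _, rfl⟩ := hb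
  rfl

theorem length_survivors_delete_one {l : ℕ} (x : Fin (l + 1) → Bool) (j : Fin (l + 1)) :
    (survivors x fun i => decide (i = j)).length = l := by
  rw [survivors, List.length_map, ← List.countP_eq_length_filter]
  have h := List.length_eq_countP_add_countP (fun i : Fin (l + 1) => decide (i = j))
    (l := List.finRange (l + 1))
  have h1 : List.countP (fun i : Fin (l + 1) => decide (i = j)) (List.finRange (l + 1)) = 1 :=
    List.count_eq_one_of_mem (List.nodup_finRange (l + 1)) (List.mem_finRange j)
  rw [h1, List.length_finRange] at h
  have h2 : ∀ i : Fin (l + 1), (!decide (i = j)) = decide ¬(decide (i = j) = true) := by simp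
  simp only [h2]
  omega

/-- Deleting a letter of the second half of `0^L 1 0^(L+1)` leaves the palindrome `0^L 1 0^L`. -/
theorem survivors_offCenter_deleteOne (L : ℕ) (j : Fin (L + 1)) :
    survivors (offCenter L) (deleteOne L j) =
      List.replicate L false ++ true :: List.replicate L false := by
  rw [survivors_add]
  have h1 : ∀ i : Fin (L + 1), offCenter L (Fin.natAdd (L + 1) i) = false := by
    intro i
    simp only [offCenter, Fin.val_natAdd, decide_eq_false_iff_not]
    omega
  have h2 : ∀ i : Fin (L + 1), deleteOne L j (Fin.natAdd (L + 1) i) = decide (i = j) := by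
    intro i
    simp [deleteOne]
  have h3 : ∀ i : Fin (L + 1), deleteOne L j (Fin.castAdd (L + 1) i) = false := by
    intro i
    simp only [deleteOne, decide_eq_false_iff_not, Fin.ext_iff, Fin.val_castAdd, Fin.val_natAdd]
    omega
  simp only [h1, h2, h3]
  rw [survivors_false, length_survivors_delete_one]
  have h4 : survivors (fun i => offCenter L (Fin.castAdd (L + 1) i)) (fun _ => false) =
      List.replicate L false ++ [true] := by
    simp only [survivors, Bool.not_false, List.filter_true]
    rw [← List.ofFn_eq_map, List.ofFn_succ', List.concat_eq_append, ← List.ofFn_const]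
    congr 1
    · congr 1
      funext i
      simp [offCenter, i.2.ne]
    · simp [offCenter]
  rw [h4]
  simp

theorem prod_coin_deleteOne (δ : unitInterval) (L : ℕ) (j : Fin (L + 1)) :
    ∏ i, coin δ (deleteOne L j i) = coin δ true * coin δ false ^ (2 * L + 1) := by
  rw [← Finset.mul_prod_erase _ _ (Finset.mem_univ (Fin.natAdd (L + 1) j))]
  congr 1
  · simp [deleteOne]
  · rw [Finset.prod_congr rfl (g := fun _ => coin δ false), Finset.prod_const,
      Finset.card_erase_of_mem (Finset.mem_univ _), Finset.card_univ, Fintype.card_fin]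
    · congr 1
      omega
    · intro i hi
      rw [deleteOne, decide_eq_false (Finset.ne_of_mem_erase hi)]

/-- A block that equals `0^L 1 0^(L+1)` and loses one letter of its second half in each trace is
ambiguous. -/
theorem mem_ambiguousBlocks_of_offCenter {m L r M : ℕ}
    {ω : (Fin (m * (L + 1 + (L + 1)) + r) → Bool) ×
      (Fin M → Fin (m * (L + 1 + (L + 1)) + r) → Bool)} {b : Fin m}
    (hx : ∀ j, ω.1 (blockPos r b j) = offCenter L j)
    (hD : ∀ t, ∃ j, ∀ i, ω.2 t (blockPos r b i) = deleteOne L j i) : b ∈ ambiguousBlocks ω := by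
  refine mem_ambiguousBlocks.2 ⟨⟨⟨L, by omega⟩, ?_⟩, fun t => ?_⟩
  · rw [hx, hx]
    simp only [offCenter, Fin.val_rev, ne_eq, decide_eq_decide]
    intro h
    have := h.2 trivial
    omega
  · obtain ⟨j, hj⟩ := hD t
    have : blockTrace ω b t = survivors (offCenter L) (deleteOne L j) := by
      simp only [blockTrace, hx, hj]
    rw [this, survivors_offCenter_deleteOne]
    simp

/-- Lower bound for the probability that a single block is ambiguous. -/
theorem le_sum_weight_mem_ambiguousBlocks {m L r M : ℕ} (δ : unitInterval) (b : Fin m) :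
    (2⁻¹ : ℝ≥0∞) ^ (2 * (L + 1)) *
        ((L + 1 : ℕ) * (coin δ true * coin δ false ^ (2 * L + 1))) ^ M ≤
      ∑ ω : (Fin (m * (L + 1 + (L + 1)) + r) → Bool) ×
        (Fin M → Fin (m * (L + 1 + (L + 1)) + r) → Bool),
          if b ∈ ambiguousBlocks ω then weight _ M δ ω else 0 := by
  classical
  set n := m * (L + 1 + (L + 1)) + r with hn
  set p : Fin (L + 1 + (L + 1)) → Fin n := blockPos r b with hp
  have hpi : Function.Injective p := blockPos_injective r b
  have hx := sum_prod_ite_comp_eq (fun _ => (2⁻¹ : ℝ≥0∞))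
    (by rw [Fintype.sum_bool, ENNReal.inv_two_add_inv_two]) hpi (offCenter L)
  have hD : ((L + 1 : ℕ) : ℝ≥0∞) * (coin δ true * coin δ false ^ (2 * L + 1)) ≤
      ∑ D : Fin n → Bool,
        if ∃ j, ∀ i, D (p i) = deleteOne L j i then ∏ i, coin δ (D i) else 0 := by
    calc ((L + 1 : ℕ) : ℝ≥0∞) * (coin δ true * coin δ false ^ (2 * L + 1))
        = ∑ j : Fin (L + 1), ∑ D : Fin n → Bool,
            if ∀ i, D (p i) = deleteOne L j i then ∏ i, coin δ (D i) else 0 := by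
          simp only [sum_prod_ite_comp_eq (coin δ) (coin_sum δ) hpi, prod_coin_deleteOne]
          simp
      _ = ∑ D : Fin n → Bool, ∑ j : Fin (L + 1),
            if ∀ i, D (p i) = deleteOne L j i then ∏ i, coin δ (D i) else 0 := Finset.sum_comm
      _ ≤ _ := by
          refine Finset.sum_le_sum fun D _ => ?_
          split_ifs with h
          · obtain ⟨j, hj⟩ := h
            rw [Finset.sum_eq_single j, if_pos hj]
            · intro j' _ hj'
              rw [if_neg]
              intro h'
              have h0 := (hj (Fin.natAdd (L + 1) j)).symm.trans (h' (Fin.natAdd (L + 1) j))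
              simp only [deleteOne, decide_true] at h0
              have h1 := of_decide_eq_true h0.symm
              exact hj' (Fin.natAdd_injective _ _ h1).symm
            · simp
          · push Not at h
            refine (Finset.sum_eq_zero fun j _ => ?_).le
            obtain ⟨i, hi⟩ := h j
            exact if_neg fun h => hi (h i)
  have hDM := Finset.prod_univ_sum (fun _ : Fin M => (Finset.univ : Finset (Fin n → Bool)))
    fun _ D => if ∃ j, ∀ i, D (p i) = deleteOne L j i then ∏ i, coin δ (D i) else 0
  rw [Fintype.piFinset_univ, Finset.prod_const, Finset.card_univ, Fintype.card_fin] at hDM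
  calc (2⁻¹ : ℝ≥0∞) ^ (2 * (L + 1)) *
        ((L + 1 : ℕ) * (coin δ true * coin δ false ^ (2 * L + 1))) ^ M
      ≤ (∑ x : Fin n → Bool, if ∀ j, x (p j) = offCenter L j then ∏ _i : Fin n, 2⁻¹ else 0) *
          (∑ D : Fin n → Bool,
            if ∃ j, ∀ i, D (p i) = deleteOne L j i then ∏ i, coin δ (D i) else 0) ^ M := by
        rw [hx, Finset.prod_const, Finset.card_univ, Fintype.card_fin, two_mul (L + 1)]
        gcongr
    _ = ∑ ω : (Fin n → Bool) × (Fin M → Fin n → Bool),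
          (if ∀ j, ω.1 (p j) = offCenter L j then ∏ _i : Fin n, 2⁻¹ else 0) *
            ∏ t, if ∃ j, ∀ i, ω.2 t (p i) = deleteOne L j i then
              ∏ i, coin δ (ω.2 t i) else 0 := by
        rw [hDM, Finset.sum_mul_sum, Fintype.sum_prod_type]
    _ ≤ _ := by
        refine Finset.sum_le_sum fun ω _ => ?_
        by_cases h1 : ∀ j, ω.1 (p j) = offCenter L j
        · by_cases h2 : ∀ t, ∃ j, ∀ i, ω.2 t (p i) = deleteOne L j i
          · rw [if_pos h1, if_pos (mem_ambiguousBlocks_of_offCenter h1 h2), weight]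
            simp only [h2, if_true]
            exact le_rfl
          · push Not at h2
            obtain ⟨t, ht⟩ := h2
            rw [Finset.prod_eq_zero (Finset.mem_univ t), mul_zero]
            · exact zero_le
            · rw [if_neg]
              push Not
              exact ht
        · rw [if_neg h1, zero_mul]
          exact zero_le

/-- Lower bound for the expected number of ambiguous blocks. -/
theorem le_sum_weight_mul_card_ambiguousBlocks (m L r M : ℕ) (δ : unitInterval) :
    m * ((2⁻¹ : ℝ≥0∞) ^ (2 * (L + 1)) *
        ((L + 1 : ℕ) * (coin δ true * coin δ false ^ (2 * L + 1))) ^ M) ≤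
      ∑ ω : (Fin (m * (L + 1 + (L + 1)) + r) → Bool) ×
        (Fin M → Fin (m * (L + 1 + (L + 1)) + r) → Bool),
          weight _ M δ ω * (ambiguousBlocks ω).card := by
  have h : ∀ ω : (Fin (m * (L + 1 + (L + 1)) + r) → Bool) ×
      (Fin M → Fin (m * (L + 1 + (L + 1)) + r) → Bool),
      weight _ M δ ω * (ambiguousBlocks ω).card =
        ∑ b : Fin m, if b ∈ ambiguousBlocks ω then weight _ M δ ω else 0 := by
    intro ω
    rw [Finset.sum_ite_mem, Finset.univ_inter, Finset.sum_const, nsmul_eq_mul, mul_comm]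
  simp only [h]
  rw [Finset.sum_comm]
  calc _ = ∑ _b : Fin m, ((2⁻¹ : ℝ≥0∞) ^ (2 * (L + 1)) *
        ((L + 1 : ℕ) * (coin δ true * coin δ false ^ (2 * L + 1))) ^ M) := by simp
    _ ≤ _ := Finset.sum_le_sum fun b _ => le_sum_weight_mem_ambiguousBlocks δ b

theorem coin_true (δ : unitInterval) : coin δ true = ENNReal.ofReal δ := rfl

theorem coin_false (δ : unitInterval) : coin δ false = ENNReal.ofReal (1 - δ) := rfl

/-! ### Lower bounds for the expected edit distance -/

/-- If all traces of a single letter are empty, the hypothesis is wrong for one of the two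
letters. -/
theorem le_expectedEditDist_one (M : ℕ) (δ : unitInterval) (A : Algorithm M) :
    ENNReal.ofReal (2⁻¹ * (δ : ℝ) ^ M) ≤ expectedEditDist 1 M δ A := by
  rw [expectedEditDist_eq, Fintype.sum_prod_type]
  have htr : ∀ x : Fin 1 → Bool, traces (M := M) (x, fun _ _ => true) = fun _ => [] := by
    intro x
    funext t
    simp [traces, survivors]
  have hw : ∀ x : Fin 1 → Bool, weight 1 M δ (x, fun _ _ => true) =
      ENNReal.ofReal (2⁻¹ * (δ : ℝ) ^ M) := by
    intro x
    rw [ENNReal.ofReal_mul (by norm_num), ENNReal.ofReal_pow δ.2.1, ← coin_true,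
      ENNReal.ofReal_inv_of_pos (by norm_num)]
    simp [weight]
  have hd : (1 : ℝ≥0∞) ≤ ∑ x : Fin 1 → Bool,
      expect (A δ fun _ => []) fun w => (editDist w (List.ofFn x) : ℝ≥0∞) := by
    rw [sum_expect, ← expect_const (A δ fun _ => []) 1]
    refine expect_mono _ fun w => ?_
    by_cases h : w = [true]
    · have h0 : 1 ≤ editDist w (List.ofFn fun _ : Fin 1 => false) := by
        refine Nat.one_le_iff_ne_zero.2 fun h0 => ?_
        simpa [h] using eq_of_editDist_eq_zero h0
      exact (Nat.one_le_cast.2 h0).trans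
        (Finset.single_le_sum (f := fun x : Fin 1 → Bool => (editDist w (List.ofFn x) : ℝ≥0∞))
          (fun _ _ => zero_le) (Finset.mem_univ fun _ => false))
    · have h0 : 1 ≤ editDist w (List.ofFn fun _ : Fin 1 => true) := by
        refine Nat.one_le_iff_ne_zero.2 fun h0 => h ?_
        simpa using eq_of_editDist_eq_zero h0
      exact (Nat.one_le_cast.2 h0).trans
        (Finset.single_le_sum (f := fun x : Fin 1 → Bool => (editDist w (List.ofFn x) : ℝ≥0∞))
          (fun _ _ => zero_le) (Finset.mem_univ fun _ => true))
  calc ENNReal.ofReal (2⁻¹ * (δ : ℝ) ^ M)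
      ≤ ENNReal.ofReal (2⁻¹ * (δ : ℝ) ^ M) * ∑ x : Fin 1 → Bool,
          expect (A δ fun _ => []) fun w => (editDist w (List.ofFn x) : ℝ≥0∞) :=
        le_mul_of_one_le_right zero_le hd
    _ = ∑ x : Fin 1 → Bool, weight 1 M δ (x, fun _ _ => true) *
          expect (A δ (traces (x, fun _ _ => true))) fun w =>
            (editDist w (List.ofFn x) : ℝ≥0∞) := by
        simp only [hw, htr, Finset.mul_sum]
    _ ≤ _ := Finset.sum_le_sum fun x _ => Finset.single_le_sum
        (f := fun D : Fin M → Fin 1 → Bool => weight 1 M δ (x, D) *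
          expect (A δ (traces (x, D))) fun w => (editDist w (List.ofFn x) : ℝ≥0∞))
        (fun _ _ => zero_le) (Finset.mem_univ fun _ _ => true)

/-- The lower bound that blocks of length `2 * (L + 1)` give. Here `2 * t` is the probability that
a block is ambiguous divided by `32 * (L + 1)`. -/
theorem le_expectedEditDist_of_block {n M L : ℕ} (hL : 2 * (L + 1) ≤ n) (δ : unitInterval)
    (h0 : 0 < (δ : ℝ)) (h1 : (δ : ℝ) < 1) (A : Algorithm M) {t : ℝ}
    (ht : t * (64 * (L + 1)) =
      2⁻¹ ^ (2 * (L + 1)) * ((L + 1) * (δ * (1 - δ) ^ (2 * L + 1) : ℝ)) ^ M)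
    (ht' : t ≤ 1 / 4) :
    ENNReal.ofReal (n * (2 * t) ^ 2) ≤ expectedEditDist n M δ A := by
  set p : ℝ := 2⁻¹ ^ (2 * (L + 1)) * ((L + 1) * (δ * (1 - δ) ^ (2 * L + 1) : ℝ)) ^ M with hp
  have h1' : 0 < 1 - (δ : ℝ) := by linarith
  have hp0 : 0 < p := by positivity
  have ht0 : 0 < t := by
    rw [← ht] at hp0
    exact pos_of_mul_pos_left hp0 (by positivity)
  obtain ⟨m, r, hn, hr⟩ : ∃ m r, n = m * (L + 1 + (L + 1)) + r ∧ r < 2 * (L + 1) :=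
    ⟨n / (2 * (L + 1)), n % (2 * (L + 1)), by rw [← two_mul, mul_comm, Nat.div_add_mod],
      Nat.mod_lt _ (by omega)⟩
  have hm : 1 ≤ m := by
    rcases Nat.eq_zero_or_pos m with rfl | h
    · omega
    · exact h
  subst hn
  set n := m * (L + 1 + (L + 1)) + r with hn
  by_cases hE : expectedEditDist n M δ A = ⊤
  · rw [hE]
    exact le_top
  have key := (mul_le_mul_left (le_sum_weight_mul_card_ambiguousBlocks m L r M δ)
    (ENNReal.ofReal (Real.log 2))).trans (sum_card_ambiguousBlocks_le δ A ht0 ht')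
  have hlog2 : 0 ≤ Real.log 2 := Real.log_nonneg (by norm_num)
  have hlog : 0 ≤ Real.log (1 / t) := Real.log_nonneg (by rw [le_div_iff₀ ht0]; linarith)
  have hleft : (m : ℝ≥0∞) * (2⁻¹ ^ (2 * (L + 1)) *
      ((L + 1 : ℕ) * (coin δ true * coin δ false ^ (2 * L + 1))) ^ M) * ENNReal.ofReal (Real.log 2)
      = ENNReal.ofReal (m * p * Real.log 2) := by
    rw [ENNReal.ofReal_mul (by positivity), ENNReal.ofReal_mul (by positivity),
      ENNReal.ofReal_natCast, hp, ENNReal.ofReal_mul (by positivity),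
      ENNReal.ofReal_pow (by positivity), ENNReal.ofReal_pow (by positivity),
      ENNReal.ofReal_mul (by positivity), ENNReal.ofReal_mul (by positivity),
      ENNReal.ofReal_pow h1'.le, ENNReal.ofReal_inv_of_pos (by norm_num), coin_true, coin_false,
      show ((L : ℝ) + 1) = ((L + 1 : ℕ) : ℝ) by push_cast; rfl, ENNReal.ofReal_natCast]
    norm_num
  obtain ⟨e, he, hEe⟩ : ∃ e : ℝ, 0 ≤ e ∧ expectedEditDist n M δ A = ENNReal.ofReal e :=
    ⟨_, ENNReal.toReal_nonneg, (ENNReal.ofReal_toReal hE).symm⟩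
  rw [hleft, hEe, ← ENNReal.ofReal_mul hlog, ← ENNReal.ofReal_add (by positivity) (by positivity),
    ENNReal.ofReal_le_ofReal_iff (by positivity)] at key
  rw [hEe]
  refine ENNReal.ofReal_le_ofReal ?_
  have hnm : (n : ℝ) ≤ m * (4 * (L + 1)) := by
    have : n ≤ m * (4 * (L + 1)) := by
      have : 1 * (2 * (L + 1)) ≤ m * (2 * (L + 1)) := Nat.mul_le_mul_right _ hm
      rw [hn]
      linarith
    calc (n : ℝ) ≤ ((m * (4 * (L + 1)) : ℕ) : ℝ) := by exact_mod_cast this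
      _ = m * (4 * (L + 1)) := by push_cast; ring
  have hlog2' : 1 / 2 ≤ Real.log 2 := by linarith [Real.log_two_gt_d9]
  have h8 : 8 * t * n ≤ m * p * Real.log 2 := by
    calc 8 * t * n ≤ 8 * t * (m * (4 * (L + 1))) := by gcongr
      _ = m * p * (1 / 2) := by rw [← ht]; ring
      _ ≤ m * p * Real.log 2 := by gcongr
  have hinv : Real.log (1 / t) * e ≤ 1 / t * e := by
    refine mul_le_mul_of_nonneg_right ?_ he
    have := Real.log_le_sub_one_of_pos (show 0 < 1 / t by positivity)
    linarith
  -- The choice of `t` makes the error term `4 * t * n` half of the entropy term.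
  have h4 : 4 * t * n ≤ 1 / t * e := by linarith
  have h5 := mul_le_mul_of_nonneg_left h4 ht0.le
  have h6 : t * (1 / t * e) = e := by field_simp
  rw [h6] at h5
  linarith

/-- With `ε * M ≤ L + 1 ≤ M` and `δ * M ≤ c`, the probability that a block of length `2 * (L + 1)`
is ambiguous, even divided by `32 * (L + 1)`, is at least the `M`-th power of a constant times
`δ * M`: the polynomial factor and the probability of the block are absorbed by `256 ^ M`, and the
undeleted letters cost a factor `(1 - c) ^ 2` per trace by Bernoulli's inequality. -/
theorem pow_le_ambiguity {M L : ℕ} {c ε δ : ℝ} (hc : c < 1) (hε : 0 ≤ ε)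
    (h0 : 0 < δ) (h1 : δ < 1) (hδ : δ * M ≤ c) (hLM : L + 1 ≤ M) (hL : ε * M ≤ L + 1) :
    (ε * (1 - c) ^ 2 / 256 * (δ * M)) ^ M * (32 * (L + 1)) ≤
      2⁻¹ ^ (2 * (L + 1)) * ((L + 1) * (δ * (1 - δ) ^ (2 * L + 1))) ^ M := by
  have h1' : 0 ≤ 1 - δ := by linarith
  have hsurv : (1 - c) ^ 2 ≤ (1 - δ) ^ (2 * L + 1) := by
    have hb := one_add_mul_le_pow (show -2 ≤ -δ by linarith) M
    rw [← sub_eq_add_neg] at hb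
    calc (1 - c) ^ 2 ≤ ((1 - δ) ^ M) ^ 2 := by
          refine pow_le_pow_left₀ (by linarith) ?_ 2
          linarith
      _ = (1 - δ) ^ (M * 2) := (pow_mul _ _ _).symm
      _ ≤ (1 - δ) ^ (2 * L + 1) := pow_le_pow_of_le_one h1' (by linarith) (by omega)
  have hconst : (32 * (L + 1) : ℝ) * 2 ^ (2 * (L + 1)) ≤ 256 ^ M := by
    have hk : ((L : ℝ) + 1) ≤ 2 ^ M := by
      have := (Nat.lt_two_pow_self (n := L + 1)).le.trans (Nat.pow_le_pow_right (by norm_num) hLM)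
      exact_mod_cast this
    have h32 : (32 : ℝ) ≤ 32 ^ M := le_self_pow₀ (by norm_num) (by omega)
    have h4 : (2 : ℝ) ^ (2 * (L + 1)) ≤ 4 ^ M := by
      rw [pow_mul]
      norm_num
      exact pow_le_pow_right₀ (by norm_num) hLM
    calc (32 * (L + 1) : ℝ) * 2 ^ (2 * (L + 1)) ≤ 32 ^ M * 2 ^ M * 4 ^ M := by gcongr
      _ = 256 ^ M := by rw [← mul_pow, ← mul_pow]; norm_num
  have hbase : ε * (1 - c) ^ 2 * (δ * M) ≤ (L + 1) * (δ * (1 - δ) ^ (2 * L + 1)) := by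
    calc ε * (1 - c) ^ 2 * (δ * M) = (ε * M) * (δ * (1 - c) ^ 2) := by ring
      _ ≤ (L + 1) * (δ * (1 - δ) ^ (2 * L + 1)) := by gcongr
  calc (ε * (1 - c) ^ 2 / 256 * (δ * M)) ^ M * (32 * (L + 1))
      = (ε * (1 - c) ^ 2 * (δ * M)) ^ M *
          (2⁻¹ ^ (2 * (L + 1)) * (32 * (L + 1) * 2 ^ (2 * (L + 1))) / 256 ^ M) := by
        rw [inv_pow, div_mul_eq_mul_div, div_pow]
        field_simp
    _ ≤ ((L + 1) * (δ * (1 - δ) ^ (2 * L + 1))) ^ M * (2⁻¹ ^ (2 * (L + 1)) * 256 ^ M / 256 ^ M) := by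
        gcongr
    _ = _ := by
        field_simp

/-- The lower bound with an explicit base `a * (δ * M)`; it remains to absorb `a` into the
exponent. -/
theorem le_expectedEditDist {c K : ℝ} (hc0 : 0 < c) (hc : c < 1) (hK : 0 < K) {n M : ℕ}
    (δ : unitInterval) (h0 : 0 < (δ : ℝ)) (h1 : (δ : ℝ) < 1) (hM : 1 ≤ M) (hδ : (δ : ℝ) * M ≤ c)
    (hMn : (M : ℝ) ≤ K * Real.log ((n : ℝ) + 1)) (A : Algorithm M) :
    ENNReal.ofReal (n * ((min 1 (1 / (3 * K)) * (1 - c) ^ 2 / 256 * (δ * M)) ^ M) ^ 2) ≤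
      expectedEditDist n M δ A := by
  set ε : ℝ := min 1 (1 / (3 * K)) with hε
  have hε0 : 0 < ε := by positivity
  have hε1 : ε ≤ 1 := min_le_left _ _
  have hεK : ε * K ≤ 1 / 3 := by
    calc ε * K ≤ 1 / (3 * K) * K := mul_le_mul_of_nonneg_right (min_le_right _ _) hK.le
      _ = 1 / 3 := by field_simp
  have hMnK : (M : ℝ) ≤ K * n := by
    refine hMn.trans (mul_le_mul_of_nonneg_left ?_ hK.le)
    have := Real.log_le_sub_one_of_pos (show 0 < (n : ℝ) + 1 by positivity)
    linarith
  have hM' : (1 : ℝ) ≤ M := by exact_mod_cast hM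
  have hεM : ε * M ≤ n / 3 := by
    calc ε * M ≤ ε * (K * n) := by gcongr
      _ = ε * K * n := by ring
      _ ≤ 1 / 3 * n := by gcongr
      _ = n / 3 := by ring
  have hc2 : (1 - c) ^ 2 ≤ 1 := pow_le_one₀ (by linarith) (by linarith)
  have hn0 : n ≠ 0 := by
    rintro rfl
    simp at hMnK
    linarith
  -- A single letter leaves no room for a block, and is treated on its own.
  rcases (show n = 1 ∨ 2 ≤ n by omega) with rfl | hn
  · refine le_trans (ENNReal.ofReal_le_ofReal ?_) (le_expectedEditDist_one M δ A)
    have hb : ε * (1 - c) ^ 2 / 256 * (δ * M) ≤ 2⁻¹ * δ := by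
      calc ε * (1 - c) ^ 2 / 256 * (δ * M) = (ε * M) * (1 - c) ^ 2 * δ / 256 := by ring
        _ ≤ ((1 : ℕ) / 3 : ℝ) * 1 * (δ : ℝ) / 256 := by gcongr
        _ ≤ 2⁻¹ * δ := by push_cast; linarith
    have hp : (ε * (1 - c) ^ 2 / 256 * (δ * M)) ^ M ≤ 2⁻¹ * (δ : ℝ) ^ M := by
      calc (ε * (1 - c) ^ 2 / 256 * (δ * M)) ^ M ≤ (2⁻¹ * (δ : ℝ)) ^ M := by gcongr
        _ = 2⁻¹ ^ M * (δ : ℝ) ^ M := mul_pow _ _ _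
        _ ≤ 2⁻¹ * (δ : ℝ) ^ M := by
            gcongr
            exact pow_le_of_le_one (by norm_num) (by norm_num) (by omega)
    have hone : 2⁻¹ * (δ : ℝ) ^ M ≤ 1 := by
      have : (δ : ℝ) ^ M ≤ 1 := pow_le_one₀ h0.le h1.le
      linarith
    rw [Nat.cast_one, one_mul]
    refine le_trans ?_ hp
    exact pow_le_of_le_one (by positivity) (hp.trans hone) (by norm_num)
  · -- The half length `L + 1` of the blocks is as large as `n` allows, but at most `M`; since
    -- `M = O(log n)`, it is at least `ε * M`.
    obtain ⟨L, hL⟩ : ∃ L, L + 1 = min M (n / 2) := ⟨min M (n / 2) - 1, by omega⟩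
    have hLn : 2 * (L + 1) ≤ n := by omega
    have hLM : L + 1 ≤ M := by omega
    have hεL : ε * M ≤ L + 1 := by
      rcases le_total M (n / 2) with h | h
      · rw [min_eq_left h] at hL
        have : (M : ℝ) = L + 1 := by exact_mod_cast hL.symm
        rw [← this]
        exact mul_le_of_le_one_left (by positivity) hε1
      · rw [min_eq_right h] at hL
        have h3 : n ≤ 3 * (L + 1) := by omega
        have h3' : (n : ℝ) ≤ 3 * (L + 1) := by exact_mod_cast h3
        linarith
    have hamb := pow_le_ambiguity hc hε0.le h0 h1 hδ hLM hεL
    set p : ℝ := 2⁻¹ ^ (2 * (L + 1)) * ((L + 1) * (δ * (1 - δ) ^ (2 * L + 1) : ℝ)) ^ M with hp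
    have ht : p / (64 * (L + 1)) * (64 * (L + 1)) = p := by field_simp
    have hδL : ((L : ℝ) + 1) * (δ * (1 - δ) ^ (2 * L + 1)) ≤ 1 := by
      have hLM' : (L : ℝ) + 1 ≤ M := by exact_mod_cast hLM
      have hs : (1 - (δ : ℝ)) ^ (2 * L + 1) ≤ 1 := pow_le_one₀ (by linarith) (by linarith)
      have hs0 : 0 ≤ (1 - (δ : ℝ)) ^ (2 * L + 1) := pow_nonneg (by linarith) _
      calc ((L : ℝ) + 1) * (δ * (1 - δ) ^ (2 * L + 1)) ≤ M * (δ * 1) := by gcongr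
        _ ≤ 1 := by linarith
    have hp1 : p ≤ 1 := by
      have hs0 : 0 ≤ (1 - (δ : ℝ)) ^ (2 * L + 1) := pow_nonneg (by linarith) _
      refine mul_le_one₀ (pow_le_one₀ (by norm_num) (by norm_num)) (by positivity) ?_
      exact pow_le_one₀ (by positivity) hδL
    have ht' : p / (64 * (L + 1)) ≤ 1 / 4 := by
      rw [div_le_iff₀ (by positivity)]
      have : (0 : ℝ) ≤ L := by positivity
      linarith
    refine le_trans (ENNReal.ofReal_le_ofReal ?_)
      (le_expectedEditDist_of_block hLn δ h0 h1 A ht ht')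
    have hle : (ε * (1 - c) ^ 2 / 256 * (δ * M)) ^ M ≤ 2 * (p / (64 * (L + 1))) := by
      rw [show 2 * (p / (64 * ((L : ℝ) + 1))) = p / (32 * (L + 1)) by field_simp; ring,
        le_div_iff₀ (by positivity)]
      exact hamb
    gcongr

end TraceReconstruction

theorem theorem2 :
    ∀ c : ℝ, 0 < c → c < 1 → ∀ K : ℝ, 0 < K →
      ∃ C : ℝ, 0 < C ∧
        ∀ (n M : ℕ) (δ : unitInterval), 0 < (δ : ℝ) → (δ : ℝ) < 1 →
          1 ≤ M → (M : ℝ) ≤ c / (δ : ℝ) → (M : ℝ) ≤ K * Real.log ((n : ℝ) + 1) →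
            ∀ A : TraceReconstruction.Algorithm M,
              ENNReal.ofReal ((n : ℝ) * ((δ : ℝ) * (M : ℝ)) ^ (C * (M : ℝ))) ≤
                TraceReconstruction.expectedEditDist n M δ A := by
  intro c hc0 hc K hK
  set a : ℝ := min 1 (1 / (3 * K)) * (1 - c) ^ 2 / 256 with ha
  have hc1 : 0 < 1 - c := by linarith
  have ha0 : 0 < a := by positivity
  have ha1 : a < 1 := by
    have h1 : (1 - c) ^ 2 ≤ 1 := pow_le_one₀ hc1.le (by linarith)
    have h2 : min 1 (1 / (3 * K)) * (1 - c) ^ 2 ≤ 1 :=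
      mul_le_one₀ (min_le_left _ _) (by positivity) h1
    linarith
  have hlogc : Real.log c < 0 := Real.log_neg hc0 hc
  have hB : 0 < Real.log a / Real.log c := div_pos_of_neg_of_neg (Real.log_neg ha0 ha1) hlogc
  refine ⟨2 * (Real.log a / Real.log c + 1), by positivity, ?_⟩
  intro n M δ h0 h1 hM hMc hMn A
  have hδ : (δ : ℝ) * M ≤ c := by
    rw [le_div_iff₀ h0] at hMc
    linarith
  have hM' : (0 : ℝ) < M := by exact_mod_cast hM
  have hs0 : 0 < (δ : ℝ) * M := by positivity
  refine le_trans (ENNReal.ofReal_le_ofReal ?_)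
    (TraceReconstruction.le_expectedEditDist hc0 hc hK δ h0 h1 hM hδ hMn A)
  rw [← ha]
  -- The exponent is chosen so that `c ^ (log a / log c) = a`.
  have hca : c ^ (Real.log a / Real.log c) = a := by
    rw [Real.rpow_def_of_pos hc0, mul_div_cancel₀ _ hlogc.ne, Real.exp_log ha0]
  have hbase : ((δ : ℝ) * M) ^ (Real.log a / Real.log c + 1) ≤ a * (δ * M) := by
    rw [Real.rpow_add_one hs0.ne']
    refine mul_le_mul_of_nonneg_right ?_ hs0.le
    exact (Real.rpow_le_rpow hs0.le hδ hB.le).trans_eq hca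
  have hexp : ((δ : ℝ) * M) ^ (2 * (Real.log a / Real.log c + 1) * M) =
      ((((δ : ℝ) * M) ^ (Real.log a / Real.log c + 1)) ^ M) ^ 2 := by
    rw [← pow_mul, ← Real.rpow_mul_natCast hs0.le]
    congr 1
    push_cast
    ring
  rw [hexp]
  gcongr
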